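/- Let $X$ be a random vector in $\mathbb{R}^d$ whose law has a density with respect to Lebesgue measure, and let $f\colon\mathbb{R}^d\to\mathbb{R}^r$ and $g\colon\mathbb{R}^r\to\mathbb{R}^r$ be Lipschitz continuous. For $h\in\{f,\,g\circ f\}$ define the conserved differential information $$C(X,h(X)) = H(h(X)) - \mathbb{E}[\log J_h(X)],\qquad H(Z)=-\int_{\mathbb{R}^r} p_Z(z)\log p_Z(z)\,\mathrm{d}z,\qquad J_h(x)=\sqrt{\det\big(Dh(x)\,Dh(x)^{\mathsf T}\big)},$$ where $p_Z$ is the Lebesgue density of $Z$, $Dh(x)\in\mathbb{R}^{r\times d}$ is the Jacobian matrix of $h$ at $x$ (which exists for almost every $x$), $\log 0=-\infty$ and $0\log 0=0$. Assume that $C(X,f(X))$ and $C(X,g(f(X)))$ are well defined in $[-\infty,\infty]$: the random vectors $f(X)$ and $g(f(X))$ have Lebesgue densities, the integrals defining $H$ and $\mathbb{E}[\log J]$ exist in $[-\infty,\infty]$, and neither difference is of the form $\infty-\infty$ or $(-\infty)-(-\infty)$. Then $$C(X,f(X)) \ge C(X,g(f(X))).$$ Say that $g$ is invertible (one-to-one)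 almost everywhere if there is a measurable $\tilde g\colon\mathbb{R}^r\to\mathbb{R}^r$ with $\tilde g(g(f(X)))=f(X)$ almost surely. If $g$ is invertible almost everywhere, then $C(X,f(X)) = C(X,g(f(X)))$. If $C(X,f(X))$ is finite, then equality holds if and only if $g$ is invertible almost everywhere. -/

import Mathlib

open MeasureTheory ProbabilityTheory

noncomputable section

/-- The integral `∫ u⁺ dμ - ∫ u⁻ dμ` of an extended-real function, as an extended real.
It is meaningful when `ExtIntegralDefined μ u` holds. -/
def extIntegral {α : Type*} [MeasurableSpace α] (μ : Measure α) (u : α → EReal) : EReal :=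
  ((∫⁻ a, (u a).toENNReal ∂μ : ENNReal) : EReal) - ((∫⁻ a, (-u a).toENNReal ∂μ : ENNReal) : EReal)

/-- At least one of `∫ u⁺ dμ`, `∫ u⁻ dμ` is finite. -/
def ExtIntegralDefined {α : Type*} [MeasurableSpace α] (μ : Measure α) (u : α → EReal) : Prop :=
  ∫⁻ a, (u a).toENNReal ∂μ ≠ ⊤ ∨ ∫⁻ a, (-u a).toENNReal ∂μ ≠ ⊤

/-- The `r × d` Jacobian matrix of `f` at `x`; the entry `(i, j)` is `∂ fᵢ / ∂ xⱼ`. -/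
def jacobianMatrix {d r : ℕ} (f : EuclideanSpace ℝ (Fin d) → EuclideanSpace ℝ (Fin r))
    (x : EuclideanSpace ℝ (Fin d)) : Matrix (Fin r) (Fin d) ℝ :=
  Matrix.of fun i j => (fderiv ℝ f x (EuclideanSpace.single j 1)) i

/-- The `r`-dimensional Jacobian determinant `J_f(x) = √(det (Df(x) Df(x)ᵀ))`. -/
def jacobianDet {d r : ℕ} (f : EuclideanSpace ℝ (Fin d) → EuclideanSpace ℝ (Fin r))
    (x : EuclideanSpace ℝ (Fin d)) : ℝ :=
  Real.sqrt (Matrix.det (jacobianMatrix f x * (jacobianMatrix f x).transpose))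

/-- `log J_f(x)`, with the value `-∞` where `J_f(x) = 0`. -/
def logJacobianDet {d r : ℕ} (f : EuclideanSpace ℝ (Fin d) → EuclideanSpace ℝ (Fin r))
    (x : EuclideanSpace ℝ (Fin d)) : EReal :=
  ENNReal.log (ENNReal.ofReal (jacobianDet f x))

/-- The integrand `-p(z) log p(z)` of the differential entropy, `p` being the Lebesgue density
of `Z` (with `0 log 0 = 0`). -/
def entropyIntegrand {Ω : Type*} [MeasurableSpace Ω] {r : ℕ} (P : Measure Ω)
    (Z : Ω → EuclideanSpace ℝ (Fin r)) (z : EuclideanSpace ℝ (Fin r)) : EReal :=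
  (Real.negMulLog (pdf Z P volume z).toReal : ℝ)

/-- The differential entropy `H(Z) = -∫ p(z) log p(z) dz`. -/
def diffEntropy {Ω : Type*} [MeasurableSpace Ω] {r : ℕ} (P : Measure Ω)
    (Z : Ω → EuclideanSpace ℝ (Fin r)) : EReal :=
  extIntegral volume (entropyIntegrand P Z)

/-- The expectation `𝔼[log J_f(X)]`. -/
def expectedLogJacobian {Ω : Type*} [MeasurableSpace Ω] {d r : ℕ} (P : Measure Ω)
    (X : Ω → EuclideanSpace ℝ (Fin d))
    (f : EuclideanSpace ℝ (Fin d) → EuclideanSpace ℝ (Fin r)) : EReal :=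
  extIntegral P (fun ω => logJacobianDet f (X ω))

/-- The conserved differential information `C(X, f(X)) = H(f(X)) - 𝔼[log J_f(X)]`. -/
def cdi {Ω : Type*} [MeasurableSpace Ω] {d r : ℕ} (P : Measure Ω)
    (X : Ω → EuclideanSpace ℝ (Fin d))
    (f : EuclideanSpace ℝ (Fin d) → EuclideanSpace ℝ (Fin r)) : EReal :=
  diffEntropy P (fun ω => f (X ω)) - expectedLogJacobian P X f

/-- `C(X, f(X))` is a well-defined element of `[-∞, ∞]`: the random variable `f(X)` has a Lebesgue
density, both integrals exist in `[-∞, ∞]`, and their difference is not of the form `∞ - ∞` or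
`(-∞) - (-∞)`. -/
structure CdiDefined {Ω : Type*} [MeasurableSpace Ω] {d r : ℕ} (P : Measure Ω)
    (X : Ω → EuclideanSpace ℝ (Fin d))
    (f : EuclideanSpace ℝ (Fin d) → EuclideanSpace ℝ (Fin r)) : Prop where
  hasPDF : HasPDF (fun ω => f (X ω)) P volume
  entropy_defined : ExtIntegralDefined volume (entropyIntegrand P (fun ω => f (X ω)))
  logJacobian_defined : ExtIntegralDefined P (fun ω => logJacobianDet f (X ω))
  not_top_sub_top : ¬ (diffEntropy P (fun ω => f (X ω)) = ⊤ ∧ expectedLogJacobian P X f = ⊤)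
  not_bot_sub_bot : ¬ (diffEntropy P (fun ω => f (X ω)) = ⊥ ∧ expectedLogJacobian P X f = ⊥)

/-- `g` is invertible (one-to-one) almost everywhere with respect to the law of `Z`: some measurable
`h` satisfies `h(g(Z)) = Z` almost surely. -/
def InvertibleAE {Ω : Type*} [MeasurableSpace Ω] {r : ℕ} (P : Measure Ω)
    (Z : Ω → EuclideanSpace ℝ (Fin r))
    (g : EuclideanSpace ℝ (Fin r) → EuclideanSpace ℝ (Fin r)) : Prop :=
  ∃ h : EuclideanSpace ℝ (Fin r) → EuclideanSpace ℝ (Fin r),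
    Measurable h ∧ ∀ᵐ ω ∂P, h (g (Z ω)) = Z ω

end

/-! Let `Y = f(X)` and `Z = g(Y)` have densities `p` and `q`. By the chain rule, `log J_{g∘f}(X) =
log |det Dg(Y)| + log J_f(X)`, so formally `C(X, f(X)) - C(X, g(f(X))) = 𝔼[-log p(Y) + log |det
Dg(Y)| + log q(Z)]`. Since `q(z)` sums `p / |det Dg|` over the preimages of `z`, one branch
contributes at most the total: `p(y) ≤ |det Dg(y)| q(g(y))` (`ae_density_le_abs_det_mul`). Hence the
bracket is nonnegative. It vanishes almost surely iff a single branch carries all the mass, that is,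
iff `g` has an almost sure left inverse.

The cancellation of `𝔼[log J_f(X)]` must survive infinite values. As `f` and `g` are Lipschitz, both
logarithms are bounded above, and `extIntegral_sub_comparison` shows that whenever the terms cannot
be cancelled both sides are `⊤`. -/

/-! ### Change of variables for densities under a non-injective map -/

section ChangeOfVariables

open Set Function
open scoped NNReal ENNReal

variable {E : Type*} [NormedAddCommGroup E] [NormedSpace ℝ E]

/-- The set of points where `g` is differentiable with invertible derivative. -/
def regularSet (g : E → E) : Set E :=
  {x | DifferentiableAt ℝ g x ∧ (fderiv ℝ g x).det ≠ 0}

theorem hasFDerivWithinAt_of_mem_regularSet {g : E → E} {x : E} (hx : x ∈ regularSet g)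
    (s : Set E) : HasFDerivWithinAt g (fderiv ℝ g x) s x :=
  hx.1.hasFDerivAt.hasFDerivWithinAt

variable [FiniteDimensional ℝ E]

/-- A linear map with nonzero determinant admits a radius such that every map approximating it
within this radius on a set is injective on that set. -/
theorem exists_approximatesLinearOn_injOn (A : E →L[ℝ] E) :
    ∃ c : ℝ≥0, c ≠ 0 ∧ (A.det ≠ 0 → ∀ (g : E → E) (s : Set E),
      ApproximatesLinearOn g A s c → InjOn g s) := by
  rcases subsingleton_or_nontrivial E with hE | hE
  · exact ⟨1, one_ne_zero, fun _ g s _ x _ y _ _ => Subsingleton.elim x y⟩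
  -- The partition theorem used below wants a nonzero radius at every `A`; for singular `A` the
  -- value is arbitrary.
  by_cases hA : A.det = 0
  · exact ⟨1, one_ne_zero, fun h => absurd hA h⟩
  let B := A.toContinuousLinearEquivOfDetNeZero hA
  have hB : 0 < ‖(B.symm : E →L[ℝ] E)‖₊⁻¹ := inv_pos.2 B.nnnorm_symm_pos
  -- An invertible `A` expands distances by at least `‖A⁻¹‖⁻¹`, so an error with a strictly smaller
  -- constant preserves injectivity.
  refine ⟨‖(B.symm : E →L[ℝ] E)‖₊⁻¹ / 2, (half_pos hB).ne', fun _ g s hs => ?_⟩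
  exact ApproximatesLinearOn.injOn (f' := B) hs (Or.inr (half_lt_self hB))

variable [MeasurableSpace E] [BorelSpace E]

theorem measurable_fderiv_det (g : E → E) : Measurable fun x => (fderiv ℝ g x).det :=
  ContinuousLinearMap.continuous_det.measurable.comp (measurable_fderiv ℝ g)

theorem measurableSet_regularSet (g : E → E) : MeasurableSet (regularSet g) :=
  (measurableSet_of_differentiableAt ℝ g).inter
    (measurable_fderiv_det g (measurableSet_singleton 0).compl)

/-- The regular set is a countable union of measurable sets on which the map is injective. -/
theorem exists_iUnion_injOn_eq_regularSet (g : E → E) :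
    ∃ t : ℕ → Set E, (∀ n, MeasurableSet (t n)) ∧ (∀ n, InjOn g (t n)) ∧
      ⋃ n, t n = regularSet g := by
  choose c hc hinj using fun A : E →L[ℝ] E => exists_approximatesLinearOn_injOn A
  obtain ⟨t, A, -, ht, hcov, happ, hA⟩ :=
    exists_partition_approximatesLinearOn_of_hasFDerivWithinAt g (regularSet g) (fderiv ℝ g)
      (fun x hx => hasFDerivWithinAt_of_mem_regularSet hx _) c hc
  refine ⟨fun n => regularSet g ∩ t n, fun n => (measurableSet_regularSet g).inter (ht n),
    fun n => ?_, ?_⟩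
  · rcases (regularSet g).eq_empty_or_nonempty with h | h
    · simp [h]
    obtain ⟨y, hy, hAy⟩ := hA h n
    exact hinj _ (hAy ▸ hy.2) g _ (happ n)
  · rw [← inter_iUnion, inter_eq_left.2 hcov]

variable {ν : Measure E} [ν.IsAddHaarMeasure] {p q : E → ℝ≥0∞} {g : E → E}

/-- The mass that the pushforward gives to the image of a set on which `g` is injective. -/
theorem measure_preimage_image_eq_setLIntegral (hg : Measurable g)
    (hpq : (ν.withDensity p).map g = ν.withDensity q) {s : Set E} (hs : MeasurableSet s)
    (hsr : s ⊆ regularSet g) (hinj : InjOn g s) :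
    ν.withDensity p (g ⁻¹' (g '' s))
      = ∫⁻ x in s, ENNReal.ofReal |(fderiv ℝ g x).det| * q (g x) ∂ν := by
  have hd : ∀ x ∈ s, HasFDerivWithinAt g (fderiv ℝ g x) s x := fun x hx =>
    hasFDerivWithinAt_of_mem_regularSet (hsr hx) s
  have hm : MeasurableSet (g '' s) := measurable_image_of_fderivWithin hs hd hinj
  rw [← Measure.map_apply hg hm, hpq, withDensity_apply _ hm,
    lintegral_image_eq_lintegral_abs_det_fderiv_mul ν hs hd hinj]

/-- A Lipschitz map carrying an absolutely continuous measure to an absolutely continuous measure is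
almost surely differentiable with invertible derivative. -/
theorem ae_mem_regularSet {μ : Measure E} (hμ : μ ≪ ν) (hμg : μ.map g ≪ ν) {K : ℝ≥0}
    (hg : LipschitzWith K g) : ∀ᵐ x ∂μ, x ∈ regularSet g := by
  let S : Set E := {x | DifferentiableAt ℝ g x ∧ (fderiv ℝ g x).det = 0}
  -- Sard: critical values form a null set, which the pushforward cannot charge. Rademacher handles
  -- the non-differentiable points.
  have hS : ν (g '' S) = 0 := addHaar_image_eq_zero_of_det_fderivWithin_eq_zero ν
    (fun x hx => hx.1.hasFDerivAt.hasFDerivWithinAt) fun x hx => hx.2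
  have h1 : ∀ᵐ x ∂μ, g x ∉ g '' S :=
    ae_of_ae_map hg.continuous.measurable.aemeasurable
      (measure_eq_zero_iff_ae_notMem.1 (hμg hS))
  filter_upwards [h1, hμ.ae_le (hg.ae_differentiableAt (μ := ν))] with x h2 h3
  exact ⟨h3, fun h => h2 ⟨x, ⟨h3, h⟩, rfl⟩⟩

/-- The density of the pushforward dominates each single-branch contribution. -/
theorem ae_density_le_abs_det_mul (hg : Measurable g) (hp : Measurable p)
    (hpq : (ν.withDensity p).map g = ν.withDensity q) :
    ∀ᵐ x ∂ν.restrict (regularSet g), p x ≤ ENNReal.ofReal |(fderiv ℝ g x).det| * q (g x) := by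
  obtain ⟨t, htm, hti, htu⟩ := exists_iUnion_injOn_eq_regularSet g
  rw [← htu, ae_restrict_iUnion_iff]
  intro n
  -- On a piece where `g` is injective, compare integrals over every measurable subset: a set has at
  -- most the mass of `g ⁻¹' (g '' s)`.
  refine ae_le_of_forall_setLIntegral_le_of_sigmaFinite hp fun s hs _ => ?_
  rw [Measure.restrict_restrict hs,
    ← measure_preimage_image_eq_setLIntegral hg hpq (hs.inter (htm n))
      (inter_subset_right.trans (htu ▸ subset_iUnion t n)) ((hti n).mono inter_subset_right),
    ← withDensity_apply _ (hs.inter (htm n))]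
  exact measure_mono (subset_preimage_image _ _)

/-- If `g` has an almost sure left inverse, then the density transforms by the usual change of
variables formula. -/
theorem ae_density_eq_abs_det_mul_of_leftInverse (hg : Measurable g) (hp : Measurable p)
    (hq : Measurable q) (hpq : (ν.withDensity p).map g = ν.withDensity q)
    (hr : ∀ᵐ x ∂ν.withDensity p, x ∈ regularSet g) {h : E → E} (hh : Measurable h)
    (hhg : ∀ᵐ x ∂ν.withDensity p, h (g x) = x) :
    ∀ᵐ x ∂ν.withDensity p, p x = ENNReal.ofReal |(fderiv ℝ g x).det| * q (g x) := by
  let G : Set E := regularSet g ∩ {x | h (g x) = x}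
  have hGm : MeasurableSet G :=
    (measurableSet_regularSet g).inter (measurableSet_eq_fun (hh.comp hg) measurable_id)
  have hG : ∀ᵐ x ∂ν.withDensity p, x ∈ G := by
    filter_upwards [hr, hhg] with x h1 h2 using ⟨h1, h2⟩
  have hinj : InjOn g G := fun x hx y hy hxy => by
    rw [← hx.2, ← hy.2, hxy]
  have key : ∀ᵐ x ∂ν.restrict G, p x = ENNReal.ofReal |(fderiv ℝ g x).det| * q (g x) := by
    refine ae_eq_of_forall_setLIntegral_eq_of_sigmaFinite hp
      ((measurable_fderiv_det g).abs.ennreal_ofReal.mul (hq.comp hg)) fun s hs _ => ?_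
    rw [Measure.restrict_restrict hs,
      ← measure_preimage_image_eq_setLIntegral hg hpq (hs.inter hGm)
      (inter_subset_right.trans inter_subset_left) (hinj.mono inter_subset_right),
      ← withDensity_apply _ (hs.inter hGm)]
    -- Any further point over the image lies outside `G`, since `g` is injective on `G`; such points
    -- are null.
    refine measure_congr ?_
    filter_upwards [hG] with x hx
    refine propext ⟨fun hxs => subset_preimage_image _ _ hxs, ?_⟩
    rintro ⟨y, hy, hyx⟩
    exact hinj hy.2 hx hyx ▸ hy
  rw [ae_restrict_iff' hGm] at key
  filter_upwards [(withDensity_absolutelyContinuous ν p).ae_le key, hG] with x h1 h2 using h1 h2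

/-- If the density transforms by the injective change of variables formula, then `g` has an almost
sure measurable left inverse. -/
theorem exists_measurable_leftInverse_of_ae_density_eq [IsFiniteMeasure (ν.withDensity p)]
    (hg : Continuous g) (hp : Measurable p)
    (hq : Measurable q) (hpq : (ν.withDensity p).map g = ν.withDensity q)
    (hr : ∀ᵐ x ∂ν.withDensity p, x ∈ regularSet g)
    (heq : ∀ᵐ x ∂ν.withDensity p, p x = ENNReal.ofReal |(fderiv ℝ g x).det| * q (g x)) :
    ∃ h : E → E, Measurable h ∧ ∀ᵐ x ∂ν.withDensity p, h (g x) = x := by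
  obtain ⟨t, htm, hti, htu⟩ := exists_iUnion_injOn_eq_regularSet g
  let D : Set E := {x | p x = ENNReal.ofReal |(fderiv ℝ g x).det| * q (g x)}
  have hD : MeasurableSet D := measurableSet_eq_fun hp
    ((measurable_fderiv_det g).abs.ennreal_ofReal.mul (hq.comp hg.measurable))
  have htD : ∀ n, MeasurableSet (t n ∩ D) := fun n => (htm n).inter hD
  have htr : ∀ n, t n ∩ D ⊆ regularSet g := fun n =>
    inter_subset_left.trans (htu ▸ subset_iUnion t n)
  have htinj : ∀ n, InjOn g (t n ∩ D) := fun n => (hti n).mono inter_subset_left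
  have himg : ∀ n, MeasurableSet (g '' (t n ∩ D)) := fun n =>
    (htD n).image_of_continuousOn_injOn hg.continuousOn (htinj n)
  -- `N n` collects the points outside the `n`-th piece that share their image with a point of it.
  -- The density equality leaves them no mass, and removing them all makes `g` injective.
  let N : ℕ → Set E := fun n => g ⁻¹' (g '' (t n ∩ D)) \ (t n ∩ D)
  have hNm : ∀ n, MeasurableSet (N n) := fun n => (hg.measurable (himg n)).diff (htD n)
  have hN : ∀ n, ν.withDensity p (N n) = 0 := by
    intro n
    have : ν.withDensity p (g ⁻¹' (g '' (t n ∩ D))) = ν.withDensity p (t n ∩ D) := by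
      rw [measure_preimage_image_eq_setLIntegral hg.measurable hpq (htD n) (htr n) (htinj n),
        withDensity_apply _ (htD n)]
      exact setLIntegral_congr_fun (htD n) fun x hx => hx.2.symm
    rw [measure_sdiff (subset_preimage_image _ _) (htD n).nullMeasurableSet (measure_ne_top _ _),
      this, tsub_self]
  let G : Set E := (regularSet g ∩ D) \ ⋃ n, N n
  have hGm : MeasurableSet G :=
    ((measurableSet_regularSet g).inter hD).diff (MeasurableSet.iUnion hNm)
  have hG : ∀ᵐ x ∂ν.withDensity p, x ∈ G := by
    have : ∀ᵐ x ∂ν.withDensity p, x ∉ ⋃ n, N n := by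
      rw [← measure_eq_zero_iff_ae_notMem, measure_iUnion_null_iff]
      exact hN
    filter_upwards [hr, heq, this] with x h1 h2 h3 using ⟨⟨h1, h2⟩, h3⟩
  have hinj : InjOn g G := by
    intro x hx y hy hxy
    obtain ⟨n, hn⟩ := mem_iUnion.1 (htu.symm ▸ hx.1.1 : x ∈ ⋃ n, t n)
    have hxn : x ∈ t n ∩ D := ⟨hn, hx.1.2⟩
    refine htinj n hxn ?_ hxy
    by_contra hyn
    exact hy.2 (mem_iUnion.2 ⟨n, ⟨x, hxn, hxy⟩, hyn⟩)
  -- Lusin–Souslin: a continuous injection on a Borel set is a measurable embedding, so its inverse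
  -- extends measurably.
  obtain ⟨h, hh, hhg⟩ := (hg.continuousOn.measurableEmbedding hGm hinj).exists_measurable_extend
    measurable_subtype_coe fun x => ⟨x⟩
  refine ⟨h, hh, ?_⟩
  filter_upwards [hG] with x hx
  exact congrFun hhg ⟨x, hx⟩

end ChangeOfVariables

/-! ### Extended-real integrals and their differences -/

section ExtendedIntegral

open scoped ENNReal

variable {α : Type*} [MeasurableSpace α] {μ : Measure α}

theorem extIntegral_congr_ae {u v : α → EReal} (h : u =ᵐ[μ] v) :
    extIntegral μ u = extIntegral μ v := by
  rw [extIntegral, extIntegral,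
    lintegral_congr_ae (h.mono fun x hx => congrArg EReal.toENNReal hx),
    lintegral_congr_ae (h.mono fun x hx => congrArg (fun y : EReal => (-y).toENNReal) hx)]

theorem extIntegral_mono_ae {u v : α → EReal} (h : u ≤ᵐ[μ] v) :
    extIntegral μ u ≤ extIntegral μ v := by
  refine EReal.sub_le_sub ?_ ?_ <;> refine EReal.coe_ennreal_le_coe_ennreal_iff.2
    (lintegral_mono_ae (h.mono fun x hx => EReal.toENNReal_le_toENNReal ?_))
  · exact hx
  · exact EReal.neg_le_neg_iff.2 hx

/-- Definedness is not needed here because `⊤ - ⊤ = ⊥` in `EReal`; for the value `⊤` it is. -/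
theorem extIntegral_eq_bot {u : α → EReal}
    (hu : ∫⁻ a, (-u a).toENNReal ∂μ = ⊤) : extIntegral μ u = ⊥ := by
  rw [extIntegral, hu, EReal.coe_ennreal_top, EReal.sub_top]

theorem extIntegral_eq_top {u : α → EReal} (h : ExtIntegralDefined μ u)
    (hu : ∫⁻ a, (u a).toENNReal ∂μ = ⊤) : extIntegral μ u = ⊤ := by
  have := h.resolve_left (not_not.2 hu)
  rw [extIntegral, hu, EReal.coe_ennreal_top, EReal.top_sub]
  simpa using this

theorem extIntegral_coe_of_integrable {a : α → ℝ} (ha : Integrable a μ) :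
    extIntegral μ (fun x => (a x : EReal)) = ((∫ x, a x ∂μ : ℝ) : EReal) := by
  have h1 : ∫⁻ x, ENNReal.ofReal (a x) ∂μ ≠ ⊤ := ha.lintegral_lt_top.ne
  have h2 : ∫⁻ x, ENNReal.ofReal (-a x) ∂μ ≠ ⊤ := ha.neg.lintegral_lt_top.ne
  rw [integral_eq_lintegral_pos_part_sub_lintegral_neg_part ha, EReal.coe_sub,
    EReal.coe_ennreal_toReal h1, EReal.coe_ennreal_toReal h2]
  simp only [extIntegral, ← EReal.coe_neg, EReal.real_coe_toENNReal]

theorem integrable_of_lintegral_ofReal_ne_top {a : α → ℝ} (ha : AEMeasurable a μ)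
    (h1 : ∫⁻ x, ENNReal.ofReal (a x) ∂μ ≠ ⊤) (h2 : ∫⁻ x, ENNReal.ofReal (-a x) ∂μ ≠ ⊤) :
    Integrable a μ := by
  refine ⟨ha.aestronglyMeasurable, ?_⟩
  rw [hasFiniteIntegral_iff_norm]
  refine lt_of_le_of_lt ?_ (ENNReal.add_lt_top.2 ⟨h1.lt_top, h2.lt_top⟩)
  rw [← lintegral_add_left' ha.ennreal_ofReal]
  refine lintegral_mono fun x => ?_
  rw [Real.norm_eq_abs]
  rcases le_total 0 (a x) with h | h
  · rw [abs_of_nonneg h]; exact le_self_add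
  · rw [abs_of_nonpos h]; exact le_add_self

theorem extIntegralDefined_coe {a : α → ℝ} :
    ExtIntegralDefined μ (fun x => (a x : EReal)) ↔
      ∫⁻ x, ENNReal.ofReal (a x) ∂μ ≠ ⊤ ∨ ∫⁻ x, ENNReal.ofReal (-a x) ∂μ ≠ ⊤ := by
  simp only [ExtIntegralDefined, ← EReal.coe_neg, EReal.real_coe_toENNReal]

theorem integrable_of_extIntegral_ne {a : α → ℝ} (ha : AEMeasurable a μ)
    (hd : ExtIntegralDefined μ (fun x => (a x : EReal)))
    (h1 : extIntegral μ (fun x => (a x : EReal)) ≠ ⊤)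
    (h2 : extIntegral μ (fun x => (a x : EReal)) ≠ ⊥) : Integrable a μ :=
  integrable_of_lintegral_ofReal_ne_top ha (fun h => h1 (extIntegral_eq_top hd h))
    fun h => h2 (extIntegral_eq_bot h)

/-- Positive parts are subadditive. Mostly used contrapositively, to pass an infinite part from one
function to another. -/
theorem lintegral_ofReal_ne_top_of_le_add {a b c : α → ℝ} (hb : AEMeasurable b μ)
    (h : ∀ᵐ x ∂μ, a x ≤ b x + c x) (h1 : ∫⁻ x, ENNReal.ofReal (b x) ∂μ ≠ ⊤)
    (h2 : ∫⁻ x, ENNReal.ofReal (c x) ∂μ ≠ ⊤) : ∫⁻ x, ENNReal.ofReal (a x) ∂μ ≠ ⊤ := by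
  refine ne_top_of_le_ne_top (ENNReal.add_ne_top.2 ⟨h1, h2⟩) ?_
  rw [← lintegral_add_left' hb.ennreal_ofReal]
  exact lintegral_mono_ae (h.mono fun x hx => (ENNReal.ofReal_le_ofReal hx).trans
    ENNReal.ofReal_add_le)

theorem extIntegral_coe_add {a b : α → ℝ} (ha : AEMeasurable a μ)
    (hd : ExtIntegralDefined μ (fun x => (a x : EReal))) (hb : Integrable b μ) :
    extIntegral μ (fun x => ((a x + b x : ℝ) : EReal))
      = extIntegral μ (fun x => (a x : EReal)) + ((∫ x, b x ∂μ : ℝ) : EReal) := by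
  have hb1 := hb.lintegral_lt_top.ne
  have hb2 : ∫⁻ x, ENNReal.ofReal (-b x) ∂μ ≠ ⊤ := hb.neg.lintegral_lt_top.ne
  have hbm : AEMeasurable b μ := hb.aemeasurable
  by_cases h1 : ∫⁻ x, ENNReal.ofReal (a x) ∂μ = ⊤
  · have h2 := (extIntegralDefined_coe.1 hd).resolve_left (not_not.2 h1)
    rw [extIntegral_eq_top hd h1, EReal.top_add_coe]
    refine extIntegral_eq_top (extIntegralDefined_coe.2 (Or.inr ?_)) ?_
    · exact lintegral_ofReal_ne_top_of_le_add ha.neg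
        (Filter.Eventually.of_forall fun x => (neg_add _ _).le) h2 hb2
    · by_contra h3
      exact lintegral_ofReal_ne_top_of_le_add (ha.add hbm)
        (Filter.Eventually.of_forall fun x => (add_neg_cancel_right _ _).ge) h3 hb2 h1
  by_cases h2 : ∫⁻ x, ENNReal.ofReal (-a x) ∂μ = ⊤
  · rw [extIntegral_eq_bot (u := fun x => (a x : EReal)) h2, EReal.bot_add]
    refine extIntegral_eq_bot ?_
    by_contra h3
    exact lintegral_ofReal_ne_top_of_le_add (a := fun x => -a x) (ha.add hbm).neg
      (Filter.Eventually.of_forall fun x => (by simp : -a x ≤ -(a x + b x) + b x)) h3 hb1 h2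
  have hai := integrable_of_lintegral_ofReal_ne_top ha h1 h2
  rw [extIntegral_coe_of_integrable hai,
    extIntegral_coe_of_integrable (a := fun x => a x + b x) (hai.add hb),
    integral_add hai hb, EReal.coe_add]

variable [IsFiniteMeasure μ]

theorem lintegral_toENNReal_ne_top_of_le_const {u : α → EReal} {K : ℝ}
    (hu : ∀ᵐ x ∂μ, u x ≤ (K : EReal)) : ∫⁻ x, (u x).toENNReal ∂μ ≠ ⊤ := by
  refine ne_top_of_le_ne_top ?_ (lintegral_mono_ae
    (hu.mono fun x hx => EReal.toENNReal_le_toENNReal hx))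
  rw [lintegral_const, EReal.real_coe_toENNReal]
  exact ENNReal.mul_ne_top ENNReal.ofReal_ne_top (measure_ne_top _ _)

/-- A function bounded above with extended integral different from `⊥` agrees almost everywhere
with an integrable real function. -/
theorem exists_integrable_ae_eq_coe {u : α → EReal} {K : ℝ} (hum : AEMeasurable u μ)
    (hu : ∀ᵐ x ∂μ, u x ≤ (K : EReal)) (hint : ∫⁻ x, (-u x).toENNReal ∂μ ≠ ⊤) :
    ∃ w : α → ℝ, Integrable w μ ∧ u =ᵐ[μ] fun x => (w x : EReal) := by
  have hbot : ∀ᵐ x ∂μ, u x ≠ ⊥ := by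
    filter_upwards [ae_lt_top' hum.neg.ereal_toENNReal hint] with x hx h
    simp [h] at hx
  have heq : u =ᵐ[μ] fun x => ((u x).toReal : EReal) := by
    filter_upwards [hu, hbot] with x h1 h2
    exact (EReal.coe_toReal (ne_top_of_le_ne_top (EReal.coe_ne_top K) h1) h2).symm
  refine ⟨fun x => (u x).toReal, integrable_of_lintegral_ofReal_ne_top hum.ereal_toReal ?_ ?_, heq⟩
  · refine ne_of_eq_of_ne (lintegral_congr_ae ?_) (lintegral_toENNReal_ne_top_of_le_const hu)
    filter_upwards [heq] with x hx
    rw [hx, EReal.real_coe_toENNReal, EReal.toReal_coe]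
  · refine ne_of_eq_of_ne (lintegral_congr_ae ?_) hint
    filter_upwards [heq] with x hx
    rw [hx, ← EReal.coe_neg, EReal.real_coe_toENNReal, EReal.toReal_coe]

/-- Comparison of differences of extended integrals when the subtracted integrands differ by a real
function `b`, bounded above, and the leading integrands satisfy `c ≤ a + b`. -/
theorem extIntegral_sub_comparison {a b c : α → ℝ} {u v : α → EReal} {K : ℝ}
    (ha : AEMeasurable a μ) (hb : AEMeasurable b μ) (hc : AEMeasurable c μ)
    (hu : AEMeasurable u μ) (huK : ∀ᵐ x ∂μ, u x ≤ (K : EReal)) (hbK : ∀ᵐ x ∂μ, b x ≤ K)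
    (huv : ∀ᵐ x ∂μ, v x = b x + u x) (hcab : ∀ᵐ x ∂μ, c x ≤ a x + b x)
    (had : ExtIntegralDefined μ (fun x => (a x : EReal)))
    (hcd : ExtIntegralDefined μ (fun x => (c x : EReal)))
    (hau : ¬ (extIntegral μ (fun x => (a x : EReal)) = ⊥ ∧ extIntegral μ u = ⊥))
    (hcv : ¬ (extIntegral μ (fun x => (c x : EReal)) = ⊥ ∧ extIntegral μ v = ⊥)) :
    extIntegral μ (fun x => (c x : EReal)) - extIntegral μ v
        ≤ extIntegral μ (fun x => (a x : EReal)) - extIntegral μ u ∧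
    (c =ᵐ[μ] a + b → extIntegral μ (fun x => (a x : EReal)) - extIntegral μ u
        = extIntegral μ (fun x => (c x : EReal)) - extIntegral μ v) ∧
    (extIntegral μ (fun x => (a x : EReal)) - extIntegral μ u ≠ ⊤ →
      extIntegral μ (fun x => (a x : EReal)) - extIntegral μ u ≠ ⊥ →
      extIntegral μ (fun x => (a x : EReal)) - extIntegral μ u
        = extIntegral μ (fun x => (c x : EReal)) - extIntegral μ v → c =ᵐ[μ] a + b) := by
  have hvK : ∀ᵐ x ∂μ, v x ≤ ((K + K : ℝ) : EReal) := by
    filter_upwards [huK, hbK, huv] with x h1 h2 h3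
    rw [h3, EReal.coe_add]
    exact add_le_add (EReal.coe_le_coe_iff.2 h2) h1
  have hv : AEMeasurable v μ := (hb.coe_real_ereal.add hu).congr (huv.mono fun x hx => hx.symm)
  have hconst : ∫⁻ _ : α, ENNReal.ofReal K ∂μ ≠ ⊤ := by
    rw [lintegral_const]
    exact ENNReal.mul_ne_top ENNReal.ofReal_ne_top (measure_ne_top _ _)
  -- If `∫ u = -∞`, then `v ≤ u + K` gives `∫ v = -∞`. The leading integrals are then not `⊥`, so
  -- both differences are `⊤`.
  by_cases huI : ∫⁻ x, (-u x).toENNReal ∂μ = ⊤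
  · have hvI : ∫⁻ x, (-v x).toENNReal ∂μ = ⊤ := by
      by_contra hvI
      obtain ⟨w, hw, hvw⟩ := exists_integrable_ae_eq_coe hv hvK hvI
      have huw : u =ᵐ[μ] fun x => ((w x - b x : ℝ) : EReal) := by
        filter_upwards [hvw, huv] with x h1 h2
        rw [EReal.coe_sub, ← h1, h2, EReal.add_sub_cancel_left]
      refine lintegral_ofReal_ne_top_of_le_add (a := fun x => -(w x - b x)) (b := fun x => -w x)
        (c := fun _ => K) hw.aemeasurable.neg ?_ hw.neg.lintegral_lt_top.ne hconst
        (huI ▸ lintegral_congr_ae ?_)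
      · filter_upwards [hbK] with x hx
        linarith
      · filter_upwards [huw] with x hx
        rw [hx, ← EReal.coe_neg, EReal.real_coe_toENNReal]
    have h1 := extIntegral_eq_bot huI
    have h2 := extIntegral_eq_bot hvI
    rw [h1, h2, EReal.sub_bot fun h => hau ⟨h, h1⟩, EReal.sub_bot fun h => hcv ⟨h, h2⟩]
    exact ⟨le_rfl, fun _ => rfl, fun h => absurd rfl h⟩
  obtain ⟨w, hw, huw⟩ := exists_integrable_ae_eq_coe hu huK huI
  have hvw : v =ᵐ[μ] fun x => ((b x + w x : ℝ) : EReal) := by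
    filter_upwards [huw, huv] with x h1 h2
    rw [h2, h1, EReal.coe_add]
  by_cases hbi : Integrable b μ
  · rw [extIntegral_congr_ae huw, extIntegral_congr_ae hvw, extIntegral_coe_of_integrable hw,
      extIntegral_coe_of_integrable (a := fun x => b x + w x) (hbi.add hw), integral_add hbi hw]
    have hadd := extIntegral_coe_add ha had hbi
    -- For integrable `b`, adding `∫ b` to both terms changes nothing, even at infinite `z`, because
    -- the shift is real.
    have hcancel : ∀ z : EReal, z + ((∫ x, b x ∂μ : ℝ) : EReal)
        - ((∫ x, b x ∂μ + ∫ x, w x ∂μ : ℝ) : EReal) = z - ((∫ x, w x ∂μ : ℝ) : EReal) := by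
      intro z
      induction z with
      | bot => simp
      | top => simp [-EReal.coe_add]
      | coe z => norm_cast; ring
    have hle : extIntegral μ (fun x => (c x : EReal))
        ≤ extIntegral μ (fun x => ((a x + b x : ℝ) : EReal)) :=
      extIntegral_mono_ae (hcab.mono fun x hx => EReal.coe_le_coe_iff.2 hx)
    refine ⟨?_, fun heq => ?_, fun h1 h2 heq => ?_⟩
    · rw [← hcancel, ← hadd]
      exact EReal.sub_le_sub hle le_rfl
    · rw [← hcancel, ← hadd]
      congr 1
      exact extIntegral_congr_ae (heq.mono fun x hx => by simp [hx])
    · have hai : Integrable a μ := by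
        refine integrable_of_extIntegral_ne ha had ?_ ?_ <;> intro h
        · exact h1 (by rw [h, EReal.top_sub_coe])
        · exact h2 (by rw [h, EReal.bot_sub])
      have hci : Integrable c μ := by
        refine integrable_of_extIntegral_ne hc hcd ?_ ?_ <;> intro h
        · exact h1 (by rw [heq, h, EReal.top_sub_coe])
        · exact h2 (by rw [heq, h, EReal.bot_sub])
      rw [extIntegral_coe_of_integrable hai, extIntegral_coe_of_integrable hci] at heq
      norm_cast at heq
      refine (integral_eq_iff_of_ae_le hci (hai.add hbi) hcab).1 ?_
      rw [Pi.add_def, integral_add hai hbi]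
      linarith
  -- Being bounded above, a non-integrable `b` has integral `-∞`, hence so does `v`, and `∫ c ≠ ⊥`.
  -- Now `-b ≤ a - c` forces `∫ a = ⊤`: both differences are `⊤`.
  · have hbp : ∫⁻ x, ENNReal.ofReal (b x) ∂μ ≠ ⊤ := ne_top_of_le_ne_top hconst
      (lintegral_mono_ae (hbK.mono fun x hx => ENNReal.ofReal_le_ofReal hx))
    have hbn : ∫⁻ x, ENNReal.ofReal (-b x) ∂μ = ⊤ := by
      by_contra h
      exact hbi (integrable_of_lintegral_ofReal_ne_top hb hbp h)
    have hvI : ∫⁻ x, (-v x).toENNReal ∂μ = ⊤ := by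
      by_contra hvI
      refine lintegral_ofReal_ne_top_of_le_add (a := fun x => -b x) (b := fun x => w x)
        (c := fun x => -(b x + w x)) hw.aemeasurable
        (Filter.Eventually.of_forall fun x => by ring_nf; rfl) hw.lintegral_lt_top.ne
        (ne_of_eq_of_ne (lintegral_congr_ae ?_) hvI) hbn
      filter_upwards [hvw] with x hx
      rw [hx, ← EReal.coe_neg, EReal.real_coe_toENNReal]
    have hvbot := extIntegral_eq_bot hvI
    have hcbot : extIntegral μ (fun x => (c x : EReal)) ≠ ⊥ := fun h => hcv ⟨h, hvbot⟩
    have hcn : ∫⁻ x, ENNReal.ofReal (-c x) ∂μ ≠ ⊤ := fun h => hcbot (extIntegral_eq_bot h)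
    have hatop : extIntegral μ (fun x => (a x : EReal)) = ⊤ := by
      refine extIntegral_eq_top had ?_
      by_contra hap
      exact lintegral_ofReal_ne_top_of_le_add ha
        (hcab.mono fun x hx => (by linarith : -b x ≤ a x + -c x)) hap hcn hbn
    rw [hatop, hvbot, extIntegral_congr_ae huw, extIntegral_coe_of_integrable hw,
      EReal.top_sub_coe, EReal.sub_bot hcbot]
    exact ⟨le_rfl, fun _ => rfl, fun h => absurd rfl h⟩

end ExtendedIntegral

/-! ### Chain rule and upper bounds for the Jacobian determinants -/

section Jacobian

open scoped NNReal ENNReal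

variable {d r : ℕ}

theorem jacobianMatrix_eq_toMatrix (f : EuclideanSpace ℝ (Fin d) → EuclideanSpace ℝ (Fin r))
    (x : EuclideanSpace ℝ (Fin d)) :
    jacobianMatrix f x = LinearMap.toMatrix (EuclideanSpace.basisFun (Fin d) ℝ).toBasis
      (EuclideanSpace.basisFun (Fin r) ℝ).toBasis (fderiv ℝ f x : _ →ₗ[ℝ] _) := by
  ext i j
  simp [jacobianMatrix, LinearMap.toMatrix_apply]

theorem det_jacobianMatrix (g : EuclideanSpace ℝ (Fin r) → EuclideanSpace ℝ (Fin r))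
    (y : EuclideanSpace ℝ (Fin r)) : (jacobianMatrix g y).det = (fderiv ℝ g y).det := by
  rw [jacobianMatrix_eq_toMatrix, LinearMap.det_toMatrix, ContinuousLinearMap.det]

theorem jacobianMatrix_comp {f : EuclideanSpace ℝ (Fin d) → EuclideanSpace ℝ (Fin r)}
    {g : EuclideanSpace ℝ (Fin r) → EuclideanSpace ℝ (Fin r)} {x : EuclideanSpace ℝ (Fin d)}
    (hf : DifferentiableAt ℝ f x) (hg : DifferentiableAt ℝ g (f x)) :
    jacobianMatrix (fun x => g (f x)) x = jacobianMatrix g (f x) * jacobianMatrix f x := by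
  have h := fderiv_comp x hg hf
  rw [Function.comp_def] at h
  rw [jacobianMatrix_eq_toMatrix, jacobianMatrix_eq_toMatrix, jacobianMatrix_eq_toMatrix,
    ← LinearMap.toMatrix_comp, h]
  rfl

/-- With `B = Dg` square and `A = Df`, `det (B A Aᵀ Bᵀ) = (det B)² det (A Aᵀ)`. -/
theorem jacobianDet_comp {f : EuclideanSpace ℝ (Fin d) → EuclideanSpace ℝ (Fin r)}
    {g : EuclideanSpace ℝ (Fin r) → EuclideanSpace ℝ (Fin r)} {x : EuclideanSpace ℝ (Fin d)}
    (hf : DifferentiableAt ℝ f x) (hg : DifferentiableAt ℝ g (f x)) :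
    jacobianDet (fun x => g (f x)) x = |(fderiv ℝ g (f x)).det| * jacobianDet f x := by
  rw [jacobianDet, jacobianDet, jacobianMatrix_comp hf hg, Matrix.transpose_mul,
    ← Real.sqrt_sq_eq_abs, ← Real.sqrt_mul (sq_nonneg _), ← det_jacobianMatrix]
  congr 1
  rw [Matrix.mul_assoc, Matrix.det_mul, ← Matrix.mul_assoc (jacobianMatrix f x), Matrix.det_mul _
    (jacobianMatrix g (f x)).transpose, Matrix.det_transpose]
  ring

/-- Regularity of `g` keeps the first summand real, so the sum is meaningful even where `J_f = 0`.
-/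
theorem logJacobianDet_comp {f : EuclideanSpace ℝ (Fin d) → EuclideanSpace ℝ (Fin r)}
    {g : EuclideanSpace ℝ (Fin r) → EuclideanSpace ℝ (Fin r)} {x : EuclideanSpace ℝ (Fin d)}
    (hf : DifferentiableAt ℝ f x) (hg : f x ∈ regularSet g) :
    logJacobianDet (fun x => g (f x)) x
      = (Real.log |(fderiv ℝ g (f x)).det| : ℝ) + logJacobianDet f x := by
  rw [logJacobianDet, jacobianDet_comp hf hg.1, ENNReal.ofReal_mul (abs_nonneg _),
    ENNReal.log_mul_add, ENNReal.log_ofReal_of_pos (abs_pos.2 hg.2), logJacobianDet]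

/-- `√(det (A Aᵀ))` as a function of the linear map with matrix `A`. -/
noncomputable def gramDet (A : EuclideanSpace ℝ (Fin d) →L[ℝ] EuclideanSpace ℝ (Fin r)) : ℝ :=
  let M : Matrix (Fin r) (Fin d) ℝ := Matrix.of fun i j => A (EuclideanSpace.single j 1) i
  Real.sqrt (M * M.transpose).det

theorem continuous_gramDet : Continuous (gramDet : (EuclideanSpace ℝ (Fin d) →L[ℝ]
    EuclideanSpace ℝ (Fin r)) → ℝ) := by
  have hM : Continuous fun A : EuclideanSpace ℝ (Fin d) →L[ℝ] EuclideanSpace ℝ (Fin r) =>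
      (Matrix.of fun i j => A (EuclideanSpace.single j 1) i : Matrix (Fin r) (Fin d) ℝ) :=
    continuous_matrix fun i j => by
      simp only [Matrix.of_apply]
      fun_prop
  exact Real.continuous_sqrt.comp (hM.matrix_mul hM.matrix_transpose).matrix_det

theorem measurable_logJacobianDet (f : EuclideanSpace ℝ (Fin d) → EuclideanSpace ℝ (Fin r)) :
    Measurable (logJacobianDet f) :=
  ENNReal.measurable_log.comp
    (continuous_gramDet.measurable.comp (measurable_fderiv ℝ f)).ennreal_ofReal

/-- Continuous functions of the derivative of a Lipschitz map are bounded above. -/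
theorem exists_forall_fderiv_le {E F : Type*} [NormedAddCommGroup E] [NormedSpace ℝ E]
    [FiniteDimensional ℝ E] [NormedAddCommGroup F] [NormedSpace ℝ F] [FiniteDimensional ℝ F]
    {f : E → F} {K : ℝ≥0} (hf : LipschitzWith K f) {Φ : (E →L[ℝ] F) → ℝ} (hΦ : Continuous Φ) :
    ∃ M : ℝ, ∀ x, Φ (fderiv ℝ f x) ≤ M := by
  -- Every `fderiv` of a `K`-Lipschitz map lies in the ball of radius `K`, which is compact in
  -- finite dimension.
  obtain ⟨M, hM⟩ := (isCompact_closedBall (0 : E →L[ℝ] F) K).bddAbove_image hΦ.continuousOn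
  refine ⟨M, fun x => hM ⟨fderiv ℝ f x, ?_, rfl⟩⟩
  rw [mem_closedBall_zero_iff]
  exact norm_fderiv_le_of_lipschitz ℝ hf

theorem exists_logJacobianDet_le {f : EuclideanSpace ℝ (Fin d) → EuclideanSpace ℝ (Fin r)}
    {K : ℝ≥0} (hf : LipschitzWith K f) : ∃ M : ℝ, ∀ x, logJacobianDet f x ≤ (M : EReal) := by
  obtain ⟨M, hM⟩ := exists_forall_fderiv_le hf continuous_gramDet
  refine ⟨Real.log (max M 1), fun x => ?_⟩
  rw [← ENNReal.log_ofReal_of_pos (lt_max_of_lt_right one_pos)]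
  exact ENNReal.log_le_log (ENNReal.ofReal_le_ofReal ((hM x).trans (le_max_left _ _)))

theorem exists_log_abs_det_le {g : EuclideanSpace ℝ (Fin r) → EuclideanSpace ℝ (Fin r)}
    {K : ℝ≥0} (hg : LipschitzWith K g) :
    ∃ M : ℝ, ∀ y ∈ regularSet g, Real.log |(fderiv ℝ g y).det| ≤ M := by
  obtain ⟨M, hM⟩ := exists_forall_fderiv_le hg
    (Φ := fun A => |A.det|) ContinuousLinearMap.continuous_det.abs
  exact ⟨Real.log M, fun y hy => Real.log_le_log (abs_pos.2 hy.2) (hM y)⟩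

end Jacobian

/-! ### Entropy as expected surprisal -/

section Entropy

open scoped ENNReal

variable {Ω : Type*} [MeasurableSpace Ω] {P : Measure Ω} {r : ℕ}
  {Z : Ω → EuclideanSpace ℝ (Fin r)}

/-- The surprisal `-log p(Z)`, with `p` the density of `Z`. -/
noncomputable def surprisal (P : Measure Ω) (Z : Ω → EuclideanSpace ℝ (Fin r)) (ω : Ω) : ℝ :=
  -Real.log (pdf Z P volume (Z ω)).toReal

theorem aemeasurable_surprisal [HasPDF Z P volume] : AEMeasurable (surprisal P Z) P :=
  (measurable_pdf Z P volume).ennreal_toReal.log.neg.comp_aemeasurable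
    (HasPDF.aemeasurable Z P volume)

variable [IsFiniteMeasure P]

/-- Integrating against the density is taking the expectation at `Z`. The factor `s = ±1` serves the
positive and negative parts at once. -/
theorem lintegral_ofReal_mul_negMulLog_pdf [HasPDF Z P volume] (s : ℝ) :
    ∫⁻ z, ENNReal.ofReal (s * Real.negMulLog (pdf Z P volume z).toReal)
      = ∫⁻ ω, ENNReal.ofReal (s * -Real.log (pdf Z P volume (Z ω)).toReal) ∂P := by
  rw [← pdf.lintegral_pdf_mul (X := Z) (μ := volume)
    (f := fun z => ENNReal.ofReal (s * -Real.log (pdf Z P volume z).toReal))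
    ((((measurable_pdf Z P volume).ennreal_toReal.log.neg).const_mul s).ennreal_ofReal.aemeasurable)]
  refine lintegral_congr_ae ?_
  have hfin : ∀ᵐ z, pdf Z P volume z < ⊤ := pdf.ae_lt_top
  filter_upwards [hfin] with z hz
  rw [← ENNReal.ofReal_toReal hz.ne, ENNReal.toReal_ofReal ENNReal.toReal_nonneg,
    ← ENNReal.ofReal_mul ENNReal.toReal_nonneg, Real.negMulLog]
  congr 1
  ring

theorem lintegral_entropyIntegrand_pos [HasPDF Z P volume] :
    ∫⁻ z, (entropyIntegrand P Z z).toENNReal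
      = ∫⁻ ω, ((surprisal P Z ω : ℝ) : EReal).toENNReal ∂P := by
  simpa [entropyIntegrand, surprisal] using lintegral_ofReal_mul_negMulLog_pdf (P := P) (Z := Z) 1

theorem lintegral_entropyIntegrand_neg [HasPDF Z P volume] :
    ∫⁻ z, (-entropyIntegrand P Z z).toENNReal
      = ∫⁻ ω, (-((surprisal P Z ω : ℝ) : EReal)).toENNReal ∂P := by
  simpa [entropyIntegrand, surprisal, ← EReal.coe_neg, -EReal.coe_neg] using
    lintegral_ofReal_mul_negMulLog_pdf (P := P) (Z := Z) (-1)

theorem diffEntropy_eq_extIntegral_surprisal [HasPDF Z P volume] :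
    diffEntropy P Z = extIntegral P fun ω => (surprisal P Z ω : EReal) := by
  rw [diffEntropy, extIntegral, extIntegral, lintegral_entropyIntegrand_pos,
    lintegral_entropyIntegrand_neg]

theorem extIntegralDefined_surprisal [HasPDF Z P volume]
    (h : ExtIntegralDefined volume (entropyIntegrand P Z)) :
    ExtIntegralDefined P fun ω => (surprisal P Z ω : EReal) := by
  rwa [ExtIntegralDefined, lintegral_entropyIntegrand_pos, lintegral_entropyIntegrand_neg] at h

/-- Since `p ≠ 0` forces `q ≠ 0`, all logarithms are taken at positive reals, where `log` is
monotone and injective. -/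
theorem neg_log_le_and_eq_iff {p q : ℝ≥0∞} {D : ℝ} (hp0 : p ≠ 0) (hp : p ≠ ⊤) (hq : q ≠ ⊤)
    (hD : 0 < D) (hle : p ≤ ENNReal.ofReal D * q) :
    -Real.log q.toReal ≤ -Real.log p.toReal + Real.log D ∧
      (-Real.log q.toReal = -Real.log p.toReal + Real.log D ↔ p = ENNReal.ofReal D * q) := by
  have hq0 : q ≠ 0 := by
    rintro rfl
    simp [hp0] at hle
  have hp' := ENNReal.toReal_pos hp0 hp
  have hq' := ENNReal.toReal_pos hq0 hq
  have hle' : p.toReal ≤ D * q.toReal := by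
    have := ENNReal.toReal_mono (ENNReal.mul_ne_top ENNReal.ofReal_ne_top hq) hle
    rwa [ENNReal.toReal_mul, ENNReal.toReal_ofReal hD.le] at this
  have hlog := Real.log_mul hD.ne' hq'.ne'
  have heq : p = ENNReal.ofReal D * q ↔ p.toReal = D * q.toReal := by
    rw [← ENNReal.toReal_eq_toReal_iff' hp (ENNReal.mul_ne_top ENNReal.ofReal_ne_top hq),
      ENNReal.toReal_mul, ENNReal.toReal_ofReal hD.le]
  refine ⟨by linarith [Real.log_le_log hp' hle'], ?_⟩
  rw [heq, ← Real.log_injOn_pos.eq_iff hp' (mul_pos hD hq'), hlog]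
  constructor <;> intro h <;> linarith

end Entropy

/-! ### The data processing inequality and its equality case -/

theorem theorem1 {Ω : Type*} [MeasurableSpace Ω] (P : Measure Ω) [IsProbabilityMeasure P]
    {d r : ℕ} (X : Ω → EuclideanSpace ℝ (Fin d)) (hX : HasPDF X P volume)
    (f : EuclideanSpace ℝ (Fin d) → EuclideanSpace ℝ (Fin r))
    (g : EuclideanSpace ℝ (Fin r) → EuclideanSpace ℝ (Fin r))
    (hf : ∃ K, LipschitzWith K f) (hg : ∃ K, LipschitzWith K g)
    (hCf : CdiDefined P X f) (hCgf : CdiDefined P X (fun x => g (f x))) :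
    cdi P X (fun x => g (f x)) ≤ cdi P X f ∧
    (InvertibleAE P (fun ω => f (X ω)) g → cdi P X f = cdi P X (fun x => g (f x))) ∧
    (cdi P X f ≠ ⊤ → cdi P X f ≠ ⊥ →
      (cdi P X f = cdi P X (fun x => g (f x)) ↔ InvertibleAE P (fun ω => f (X ω)) g)) := by
  obtain ⟨Kf, hf⟩ := hf
  obtain ⟨Kg, hg⟩ := hg
  have hgm : Measurable g := hg.continuous.measurable
  let Y : Ω → EuclideanSpace ℝ (Fin r) := fun ω => f (X ω)
  let Z : Ω → EuclideanSpace ℝ (Fin r) := fun ω => g (f (X ω))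
  have hYpdf : HasPDF Y P volume := hCf.hasPDF
  have hZpdf : HasPDF Z P volume := hCgf.hasPDF
  have hXm : AEMeasurable X P := HasPDF.aemeasurable X P volume
  have hYm : AEMeasurable Y P := HasPDF.aemeasurable Y P volume
  have hZm : AEMeasurable Z P := HasPDF.aemeasurable Z P volume
  let p := pdf Y P volume
  let q := pdf Z P volume
  have hp : Measurable p := measurable_pdf Y P volume
  have hq : Measurable q := measurable_pdf Z P volume
  have hYp : P.map Y = volume.withDensity p := map_eq_withDensity_pdf Y P volume
  have hZq : P.map Z = volume.withDensity q := map_eq_withDensity_pdf Z P volume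
  have hYZ : (P.map Y).map g = P.map Z :=
    AEMeasurable.map_map_of_aemeasurable hgm.aemeasurable hYm
  have hYac : P.map Y ≪ volume := HasPDF.absolutelyContinuous (X := Y)
  have hZac : P.map Z ≪ volume := HasPDF.absolutelyContinuous (X := Z)
  have hpq : (volume.withDensity p).map g = volume.withDensity q := by rw [← hYp, hYZ, hZq]
  have hr : ∀ᵐ y ∂P.map Y, y ∈ regularSet g := ae_mem_regularSet hYac (hYZ ▸ hZac) hg
  have hrY : ∀ᵐ ω ∂P, Y ω ∈ regularSet g := ae_of_ae_map hYm hr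
  have hfX : ∀ᵐ ω ∂P, DifferentiableAt ℝ f (X ω) := ae_of_ae_map hXm
    ((HasPDF.absolutelyContinuous (X := X) (μ := volume)).ae_le (hf.ae_differentiableAt (μ := volume)))
  have hp0 : ∀ᵐ ω ∂P, p (Y ω) ≠ 0 := by
    refine ae_of_ae_map (p := fun y => p y ≠ 0) hYm ?_
    rw [hYp, ae_withDensity_iff hp]
    exact Filter.Eventually.of_forall fun _ h => h
  have hpt : ∀ᵐ ω ∂P, p (Y ω) < ⊤ := ae_of_ae_map hYm (hYac.ae_le pdf.ae_lt_top)
  have hqt : ∀ᵐ ω ∂P, q (Z ω) < ⊤ := ae_of_ae_map hZm (hZac.ae_le pdf.ae_lt_top)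
  have hple : ∀ᵐ ω ∂P, p (Y ω) ≤ ENNReal.ofReal |(fderiv ℝ g (Y ω)).det| * q (Z ω) := by
    have h := (ae_restrict_iff' (measurableSet_regularSet g)).1
      (ae_density_le_abs_det_mul hgm hp hpq)
    filter_upwards [ae_of_ae_map hYm (hYac.ae_le h), hrY] with ω h1 h2 using h1 h2
  have hlog : ∀ᵐ ω ∂P, surprisal P Z ω ≤ surprisal P Y ω + Real.log |(fderiv ℝ g (Y ω)).det| ∧
      (surprisal P Z ω = surprisal P Y ω + Real.log |(fderiv ℝ g (Y ω)).det| ↔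
        p (Y ω) = ENNReal.ofReal |(fderiv ℝ g (Y ω)).det| * q (Z ω)) := by
    filter_upwards [hrY, hp0, hpt, hqt, hple] with ω h1 h2 h3 h4 h5
    exact neg_log_le_and_eq_iff h2 h3.ne h4.ne (abs_pos.2 h1.2) h5
  let b : Ω → ℝ := fun ω => Real.log |(fderiv ℝ g (Y ω)).det|
  -- Equality of surprisals is the one-branch density formula under the law of `Y`, which is
  -- equivalent to having a left inverse.
  have hinv : surprisal P Z =ᵐ[P] surprisal P Y + b ↔ InvertibleAE P Y g := by
    have hset : MeasurableSet
        {y | p y = ENNReal.ofReal |(fderiv ℝ g y).det| * q (g y)} :=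
      measurableSet_eq_fun hp
        ((measurable_fderiv_det g).abs.ennreal_ofReal.mul (hq.comp hgm))
    have hiff : surprisal P Z =ᵐ[P] surprisal P Y + b ↔
        ∀ᵐ y ∂volume.withDensity p, p y = ENNReal.ofReal |(fderiv ℝ g y).det| * q (g y) := by
      rw [← hYp, ae_map_iff hYm hset]
      exact Filter.eventually_congr (hlog.mono fun ω h => h.2)
    rw [hiff]
    rw [hYp] at hr
    have : IsFiniteMeasure (volume.withDensity p) := by
      rw [← hYp]
      infer_instance
    constructor
    · intro h
      obtain ⟨k, hk, hkg⟩ :=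
        exists_measurable_leftInverse_of_ae_density_eq hg.continuous hp hq hpq hr h
      rw [← hYp] at hkg
      exact ⟨k, hk, ae_of_ae_map hYm hkg⟩
    · rintro ⟨k, hk, hkg⟩
      refine ae_density_eq_abs_det_mul_of_leftInverse hgm hp hq hpq hr hk ?_
      rw [← hYp]
      exact (ae_map_iff hYm (measurableSet_eq_fun (hk.comp hgm) measurable_id)).2 hkg
  obtain ⟨M₁, hM₁⟩ := exists_logJacobianDet_le hf
  obtain ⟨M₂, hM₂⟩ := exists_log_abs_det_le hg
  have hHY := diffEntropy_eq_extIntegral_surprisal (P := P) (Z := Y)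
  have hHZ := diffEntropy_eq_extIntegral_surprisal (P := P) (Z := Z)
  obtain ⟨hle, heq, himp⟩ := extIntegral_sub_comparison (μ := P) (a := surprisal P Y) (b := b)
    (c := surprisal P Z) (u := fun ω => logJacobianDet f (X ω))
    (v := fun ω => logJacobianDet (fun x => g (f x)) (X ω)) (K := max M₁ M₂)
    aemeasurable_surprisal ((measurable_fderiv_det g).abs.log.comp_aemeasurable hYm)
    aemeasurable_surprisal ((measurable_logJacobianDet f).comp_aemeasurable hXm)
    (Filter.Eventually.of_forall fun ω =>
      (hM₁ _).trans (EReal.coe_le_coe_iff.2 (le_max_left _ _)))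
    (hrY.mono fun ω h => (hM₂ _ h).trans (le_max_right _ _))
    (by filter_upwards [hfX, hrY] with ω h1 h2 using logJacobianDet_comp h1 h2)
    (hlog.mono fun ω h => h.1)
    (extIntegralDefined_surprisal hCf.entropy_defined)
    (extIntegralDefined_surprisal hCgf.entropy_defined)
    (by rw [← hHY]; exact hCf.not_bot_sub_bot) (by rw [← hHZ]; exact hCgf.not_bot_sub_bot)
  rw [← hHY, ← hHZ] at hle heq himp
  exact ⟨hle, fun h => heq (hinv.2 h), fun h1 h2 =>
    ⟨fun h => hinv.1 (himp h1 h2 h), fun h => heq (hinv.2 h)⟩⟩
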